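/- Let $d\ge 1$. Let $K$ be a continuous, symmetric, positive definite, translation-invariant real-valued kernel on $\mathbb{R}^d\times\mathbb{R}^d$, and let $\mathcal K$ be its native space, i.e. the Hilbert space of functions on $\mathbb{R}^d$ with reproducing kernel $K$, with norm $\|\cdot\|_K$. For $r>0$ let $$\mathcal B_r=\{b\in\mathcal K:\ b(0)=1,\ b(y)=0 \text{ for all } \|y\|_2\ge r\},\qquad \beta_{\mathcal K}(r)=\inf\{\|b\|_K:\ b\in\mathcal B_r\}$$ be the set of bump functions of support radius $r$ and the bump norm function. Suppose that, for some real $\beta>d$, the Fourier transform $\hat K$ of $K(\cdot,0)$ satisfies $\hat K(\omega)=\Theta\big((1+\|\omega\|_2^{\beta})^{-1}\big)$, i.e. there are constants $0<c\le C$ with $$\frac{c}{1+\|\omega\|_2^{\beta}}\le \hat K(\omega)\le \frac{C}{1+\|\omega\|_2^{\beta}}\qquad\text{for (almost) all }\omega\in\mathbb{R}^d .$$ Then for every $r>0$ there is a unique norm-minimal bump function $b_r^*\in\mathcal B_r$, that is, $\|b_r^*\|_K=\beta_{\mathcal K}(r)$, and $$\beta_{\mathcal K}(r)=\|b_r^*\|_K=\Theta\big(r^{d/2-\beta/2}\big)\qquad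 (r\to 0^+).$$ The same holds with $\beta=2m$ in the Sobolev space $H_2^m(\mathbb{R}^d)$ for every real $m>d/2$, i.e. the space of continuous real-valued $f\in L_2(\mathbb{R}^d)$ with $\|f\|^2=(2\pi)^{-d}\int_{\mathbb{R}^d}(1+\|\omega\|_2^2)^m|\hat f(\omega)|^2\,d\omega<\infty$, where $\hat f(\omega)=\int_{\mathbb{R}^d} f(x)e^{-i\langle x,\omega\rangle}\,dx$ (extended to $L_2$): with this norm in place of $\|\cdot\|_K$ there is a unique norm-minimal bump function for every $r>0$, and its norm, the bump norm function, is $\Theta(r^{d/2-m})$ as $r\to0^+$. -/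

import Mathlib

open MeasureTheory FourierTransform Filter Topology Asymptotics
open scoped SchwartzMap

noncomputable section

/-- The Euclidean space `ℝ^d`. -/
abbrev Eucl (d : ℕ) : Type := EuclideanSpace ℝ (Fin d)

/-! ### Kernels and native spaces -/

/-- A continuous, symmetric, positive (semi)definite, translation-invariant real kernel on
`ℝ^d × ℝ^d`. -/
structure IsTranslationInvariantKernel {d : ℕ} (K : Eucl d → Eucl d → ℝ) : Prop where
  continuous : Continuous fun p : Eucl d × Eucl d => K p.1 p.2
  symm : ∀ x y, K x y = K y x
  nonneg : ∀ (s : Finset (Eucl d)) (c : Eucl d → ℝ), 0 ≤ ∑ x ∈ s, ∑ y ∈ s, c x * c y * K x y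
  translate : ∀ x y z, K (x + z) (y + z) = K x y

/-- `φ` is the Fourier transform of `Φ` in the sense of tempered distributions, where the
transform of a test function is `𝓕 g ξ = ∫ exp (-2πi ⟪x, ξ⟫) g x dx`. This is the classical Fourier
transform whenever `Φ` is integrable. -/
def HasFourierTransform {d : ℕ} (Φ φ : Eucl d → ℝ) : Prop :=
  LocallyIntegrable φ volume ∧
    ∀ g : 𝓢(Eucl d, ℂ), ∫ x, (Φ x : ℂ) * (𝓕 g) x = ∫ ξ, (φ ξ : ℂ) * g ξ

/-- The Fourier transform of `x ↦ K(x, 0)` is `Θ((1 + ‖ξ‖ ^ β)⁻¹)` on all of `ℝ^d`. (Passing to the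
angular frequency `ω = 2πξ`, or renormalizing the transform, only changes the constants.) -/
def HasAlgebraicFourierDecay {d : ℕ} (K : Eucl d → Eucl d → ℝ) (β : ℝ) : Prop :=
  ∃ φ : Eucl d → ℝ, HasFourierTransform (fun x => K x 0) φ ∧
    ∃ c C : ℝ, 0 < c ∧ 0 < C ∧
      ∀ᵐ ξ : Eucl d, c * (1 + ‖ξ‖ ^ β)⁻¹ ≤ φ ξ ∧ φ ξ ≤ C * (1 + ‖ξ‖ ^ β)⁻¹

/-- The reproducing kernel Hilbert space `H` of real functions on `ℝ^d` is the native space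
of `K`, i.e. its reproducing kernel is `K`. -/
def IsNativeSpace {d : ℕ} (K : Eucl d → Eucl d → ℝ) (H : Type*) [NormedAddCommGroup H]
    [InnerProductSpace ℝ H] [CompleteSpace H] [RKHS ℝ H (Eucl d) ℝ] : Prop :=
  ∀ x y, RKHS.kernel H x y 1 = K x y

/-! ### The Sobolev space `H_2^m(ℝ^d)`, for `m > d / 2` -/

/-- The real Sobolev space `H_2^m(ℝ^d)` in the range `m > d / 2`, defined through the (`L²`) Fourier
transform; its elements are identified with their continuous representatives.
The frequency weight is `(1 + ‖ω‖²) ^ m` with `ω = 2πξ`, so that the squared norm is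
`⟨(1 - Δ)^m f, f⟩`. -/
structure SobolevSpace (d : ℕ) (m : ℝ) where
  toFun : Eucl d → ℝ
  continuous_toFun : Continuous toFun
  memLp_two : MemLp (fun x => (toFun x : ℂ)) 2 (volume : Measure (Eucl d))
  memLp_weighted : MemLp (fun ξ => (((1 + (2 * Real.pi * ‖ξ‖) ^ 2) ^ (m / 2) : ℝ) : ℂ) *
    (𝓕 (memLp_two.toLp _) : Lp ℂ 2 (volume : Measure (Eucl d))) ξ) 2 (volume : Measure (Eucl d))

namespace SobolevSpace

instance instFunLike (d : ℕ) (m : ℝ) : FunLike (SobolevSpace d m) (Eucl d) ℝ where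
  coe := toFun
  coe_injective f g h := by
    cases f; cases g; congr

/-- `‖f‖² = ∫ (1 + ‖2πξ‖²) ^ m |𝓕 f ξ|² dξ`. -/
instance instNorm (d : ℕ) (m : ℝ) : Norm (SobolevSpace d m) where
  norm f := Real.sqrt (∫ ξ, (1 + (2 * Real.pi * ‖ξ‖) ^ 2) ^ m *
    ‖(𝓕 (f.memLp_two.toLp _) : Lp ℂ 2 (volume : Measure (Eucl d))) ξ‖ ^ 2)

end SobolevSpace

/-! ### Bump functions -/

/-- The bump functions of support radius `r` in a normed space `H` of functions on `ℝ^d`. -/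
def bumpSet {d : ℕ} (H : Type*) [FunLike H (Eucl d) ℝ] (r : ℝ) : Set H :=
  {b | b 0 = 1 ∧ ∀ y : Eucl d, r ≤ ‖y‖ → b y = 0}

/-- The bump norm function `β(r) = inf {‖b‖ : b ∈ 𝓑_r}`. -/
def bumpNorm {d : ℕ} (H : Type*) [Norm H] [FunLike H (Eucl d) ℝ] (r : ℝ) : ℝ :=
  sInf ((fun b : H => ‖b‖) '' bumpSet H r)

/-- `b` is a norm-minimal bump function of support radius `r`. -/
def IsNormMinimalBump {d : ℕ} {H : Type*} [Norm H] [FunLike H (Eucl d) ℝ] (r : ℝ) (b : H) : Prop :=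
  b ∈ bumpSet H r ∧ ‖b‖ = bumpNorm H r

end

/-! Everything is read off a spectral density `φ`: the kernel is the inverse Fourier transform of
`φ`, so `‖∑ cᵢ k_{xᵢ}‖² = ∫ φ |∑ cᵢ e_{xᵢ}|²` for plane waves `e_x`
(`HasSpectralDensity.norm_sq_sum`). Point evaluations are continuous, so the bump functions form a
closed convex set, and once it is nonempty its point nearest to `0` exists and is unique.

Lower bound: pair `b` with the `n`-th difference `u = ∑ (-1)^(n-j) (n choose j) k_{jx}`, where `‖x‖
= r` and `2n ≥ β`. All nodes but the origin lie outside the support, so `⟪b, u⟫ = (-1)^n` and `1 ≤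
‖b‖ ‖u‖`. Here `‖u‖² = ∫ φ |e_x - 1|^(2n)`, and `|e_x - 1| ≤ min (2, 2πr‖ξ‖)`; rescaling by `r`
gives `O(r^(β-d))`, with a convergent integral because `β > d`.

Upper bound: dilate one smooth bump `f` to `f(·/r)`, whose transform is `r^d h(rξ)`. A function with
transform `h` lies in the space with norm at most `(∫ |h|²/φ)^(1/2)`: Cauchy–Schwarz bounds the
functional `k_x ↦ f x` on the span of the kernel functions, and Riesz represents it
(`HasSpectralDensity.exists_eq_of_integrable`). For `r ≤ 1` scaling gives `O(r^(d-β))` for the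
squared norm.

For native spaces, the distributional hypothesis gives an integrable `φ`, and Fourier inversion with
continuity makes it a spectral density. For Sobolev spaces, the weighted Fourier transform is a
norm-preserving bijection onto a closed real subspace of `L²`, which is a reproducing kernel space
with density `(1 + ‖2πξ‖²)^(-m)`. -/

noncomputable section

/-! ### Minimal-norm bump functions by projection -/

section MinimalBump

variable {d : ℕ} {H : Type*} [NormedAddCommGroup H] [InnerProductSpace ℝ H]
  [RKHS ℝ H (Eucl d) ℝ]

lemma convex_bumpSet (r : ℝ) : Convex ℝ (bumpSet H r) := by
  rintro f ⟨hf0, hf⟩ g ⟨hg0, hg⟩ a b ha hb hab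
  refine ⟨by simp [hf0, hg0, hab], fun y hy => by simp [hf y hy, hg y hy]⟩

lemma isClosed_bumpSet (r : ℝ) : IsClosed (bumpSet H r) := by
  have : bumpSet H r = {b : H | b 0 = 1} ∩ ⋂ (y : Eucl d) (_ : r ≤ ‖y‖), {b : H | b y = 0} := by
    ext b; simp [bumpSet]
  rw [this]
  exact (isClosed_eq (RKHS.continuous_eval 0) continuous_const).inter
    (isClosed_biInter fun y _ => isClosed_eq (RKHS.continuous_eval y) continuous_const)

/-- A nonempty set of bump functions in a reproducing kernel Hilbert space has a unique element of
minimal norm. -/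
lemma existsUnique_isNormMinimalBump [CompleteSpace H] {r : ℝ} (hne : (bumpSet H r).Nonempty) :
    ∃! b : H, IsNormMinimalBump r b := by
  have hinf : bumpNorm H r = ⨅ w : bumpSet H r, ‖(0 : H) - w‖ := by
    simp [bumpNorm, sInf_image']
  obtain ⟨v, hv, hvn⟩ := exists_norm_eq_iInf_of_complete_convex hne
    (isClosed_bumpSet r).isComplete (convex_bumpSet r) 0
  refine ⟨v, ⟨hv, by rw [hinf, ← hvn]; simp⟩, fun w ⟨hw, hwn⟩ => ?_⟩
  rw [norm_eq_iInf_iff_real_inner_le_zero (convex_bumpSet r) hv] at hvn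
  have h1 := hvn w hw
  have h2 : ‖(0 : H) - w‖ = ⨅ w : bumpSet H r, ‖(0 : H) - w‖ := by rw [← hinf, ← hwn]; simp
  rw [norm_eq_iInf_iff_real_inner_le_zero (convex_bumpSet r) hw] at h2
  have h3 := h2 v hv
  -- The variational inequalities at the two minimizers add up to `‖w - v‖² ≤ 0`.
  have h4 : inner ℝ (w - v) (w - v) ≤ 0 := by
    simp only [inner_sub_left, inner_sub_right, zero_sub, inner_neg_left] at *
    linarith
  rw [real_inner_self_eq_norm_sq] at h4
  exact sub_eq_zero.1 (norm_eq_zero.1 (pow_eq_zero_iff two_ne_zero |>.1 (le_antisymm h4 (sq_nonneg _))))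

lemma bumpNorm_le {r : ℝ} {b : H} (hb : b ∈ bumpSet H r) : bumpNorm H r ≤ ‖b‖ :=
  csInf_le ⟨0, by rintro _ ⟨b, -, rfl⟩; exact norm_nonneg b⟩ ⟨b, hb, rfl⟩

end MinimalBump

/-! ### Representation of functionals bounded on a range -/

section Riesz

/-- A linear functional that is bounded by the norm of the image under a linear map `L` into a real
Hilbert space is represented on that image by a vector. -/
lemma exists_inner_eq_of_abs_le {M H : Type*} [AddCommGroup M] [Module ℝ M]
    [NormedAddCommGroup H] [InnerProductSpace ℝ H] [CompleteSpace H]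
    (L : M →ₗ[ℝ] H) (l : M →ₗ[ℝ] ℝ) {A : ℝ} (hA : 0 ≤ A) (h : ∀ c, |l c| ≤ A * ‖L c‖) :
    ∃ b : H, ‖b‖ ≤ A ∧ ∀ c, inner ℝ b (L c) = l c := by
  have hker : LinearMap.ker L ≤ LinearMap.ker l := fun c hc => by
    have := h c
    rw [LinearMap.mem_ker.1 hc, norm_zero, mul_zero] at this
    exact abs_nonpos_iff.1 this
  let g : LinearMap.range L →ₗ[ℝ] ℝ :=
    (Submodule.liftQ _ l hker) ∘ₗ L.quotKerEquivRange.symm.toLinearMap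
  have hg : ∀ c, g ⟨L c, c, rfl⟩ = l c := fun c => by
    have : (⟨L c, c, rfl⟩ : LinearMap.range L) = L.quotKerEquivRange (Submodule.Quotient.mk c) := by
      ext; simp
    simp only [g, LinearMap.comp_apply, LinearEquiv.coe_coe, this, LinearEquiv.symm_apply_apply,
      Submodule.liftQ_apply]
  have hbd : ∀ y, ‖g y‖ ≤ A * ‖y‖ := by
    rintro ⟨_, c, rfl⟩
    rw [hg]
    exact h c
  -- The range need not be closed, so Hahn–Banach extends `g` before Riesz is applied.
  obtain ⟨G, hG, hGn⟩ := exists_extension_norm_eq _ (g.mkContinuous A hbd)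
  refine ⟨(InnerProductSpace.toDual ℝ H).symm G, ?_, fun c => ?_⟩
  · rw [LinearIsometryEquiv.norm_map, hGn]
    exact LinearMap.mkContinuous_norm_le _ hA _
  · rw [InnerProductSpace.toDual_symm_apply]
    have := hG ⟨L c, c, rfl⟩
    rw [this, LinearMap.mkContinuous_apply, hg]

end Riesz

/-! ### Plane waves and spectral densities -/

section Spectral

/-- The plane wave `ξ ↦ exp (2πi ⟪ξ, x⟫)`. -/
def planeWave {d : ℕ} (x ξ : Eucl d) : ℂ :=
  Complex.exp (((2 * Real.pi * inner ℝ ξ x : ℝ) : ℂ) * Complex.I)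

variable {d : ℕ}

lemma norm_planeWave (x ξ : Eucl d) : ‖planeWave x ξ‖ = 1 := Complex.norm_exp_ofReal_mul_I _

@[fun_prop]
lemma continuous_planeWave (x : Eucl d) : Continuous (planeWave x) := by
  unfold planeWave; fun_prop

lemma planeWave_add (x y ξ : Eucl d) : planeWave (x + y) ξ = planeWave x ξ * planeWave y ξ := by
  simp only [planeWave, inner_add_right, ← Complex.exp_add]
  push_cast; ring_nf

lemma star_planeWave (x ξ : Eucl d) : starRingEnd ℂ (planeWave x ξ) = planeWave (-x) ξ := by
  simp only [planeWave, ← Complex.exp_conj, inner_neg_right, map_mul, Complex.conj_ofReal,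
    Complex.conj_I]
  push_cast; ring_nf

lemma planeWave_natCast_smul (n : ℕ) (x ξ : Eucl d) :
    planeWave ((n : ℝ) • x) ξ = planeWave x ξ ^ n := by
  simp only [planeWave, ← Complex.exp_nat_mul, real_inner_smul_right]
  push_cast; ring_nf

lemma planeWave_smul (t : ℝ) (x ξ : Eucl d) : planeWave (t • x) ξ = planeWave x (t • ξ) := by
  simp [planeWave, inner_smul_left, inner_smul_right]

lemma fourierInv_eq_integral_planeWave (h : Eucl d → ℂ) (x : Eucl d) :
    𝓕⁻ h x = ∫ ξ, planeWave x ξ * h ξ := by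
  simp [Real.fourierInv_eq', planeWave]

lemma MeasureTheory.Integrable.planeWave_mul {h : Eucl d → ℂ} (hh : Integrable h) (x : Eucl d) :
    Integrable fun ξ => planeWave x ξ * h ξ :=
  hh.bdd_mul (continuous_planeWave x).aestronglyMeasurable (c := 1)
    (ae_of_all _ fun ξ => (norm_planeWave x ξ).le)

/-- The Fourier transform of a kernel of a reproducing kernel Hilbert space, as a spectral density:
the kernel is `(x, y) ↦ ∫ φ(ξ) exp (2πi ⟪ξ, x - y⟫) dξ`. -/
def HasSpectralDensity (H : Type*) [NormedAddCommGroup H] [InnerProductSpace ℝ H] [CompleteSpace H]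
    [RKHS ℝ H (Eucl d) ℝ] (φ : Eucl d → ℝ) : Prop :=
  Integrable φ ∧ ∀ x y, ((RKHS.kernel H x y 1 : ℝ) : ℂ) = 𝓕⁻ (fun ξ => (φ ξ : ℂ)) (x - y)

variable {H : Type*} [NormedAddCommGroup H] [InnerProductSpace ℝ H] [CompleteSpace H]
    [RKHS ℝ H (Eucl d) ℝ]

lemma inner_kerFun_one (f : H) (x : Eucl d) : inner ℝ f (RKHS.kerFun H x 1) = f x := by
  simp

/-- The norm of a linear combination of kernel functions as an integral over the frequencies. -/
lemma HasSpectralDensity.norm_sq_sum {φ : Eucl d → ℝ} (hφ : HasSpectralDensity H φ)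
    {ι : Type*} (s : Finset ι) (c : ι → ℝ) (x : ι → Eucl d) :
    ‖∑ i ∈ s, c i • RKHS.kerFun H (x i) 1‖ ^ 2 =
      ∫ ξ, φ ξ * ‖∑ i ∈ s, (c i : ℂ) * planeWave (x i) ξ‖ ^ 2 := by
  have h1 : ∀ ξ, ((φ ξ * ‖∑ i ∈ s, (c i : ℂ) * planeWave (x i) ξ‖ ^ 2 : ℝ) : ℂ) =
      ∑ i ∈ s, ∑ j ∈ s, (c i : ℂ) * c j * (planeWave (x i - x j) ξ * φ ξ) := fun ξ => by
    push_cast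
    rw [← Complex.mul_conj', map_sum, Finset.sum_mul_sum, Finset.mul_sum]
    refine Finset.sum_congr rfl fun i _ => ?_
    rw [Finset.mul_sum]
    refine Finset.sum_congr rfl fun j _ => ?_
    rw [map_mul, star_planeWave, sub_eq_add_neg, planeWave_add, Complex.conj_ofReal]
    ring
  have hi : ∀ z, Integrable fun ξ => planeWave z ξ * (φ ξ : ℂ) := fun z => hφ.1.ofReal.planeWave_mul z
  apply Complex.ofReal_injective
  rw [← integral_complex_ofReal]
  simp_rw [h1]
  rw [integral_finsetSum _ fun i _ => integrable_finsetSum _ fun j _ => (hi _).const_mul _]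
  rw [← real_inner_self_eq_norm_sq, sum_inner]
  push_cast
  refine Finset.sum_congr rfl fun i _ => ?_
  rw [integral_finsetSum _ fun j _ => (hi _).const_mul _, inner_sum]
  push_cast
  refine Finset.sum_congr rfl fun j _ => ?_
  rw [integral_const_mul, ← fourierInv_eq_integral_planeWave, ← hφ.2, real_inner_smul_left,
    real_inner_smul_right, real_inner_comm, inner_kerFun_one, RKHS.kerFun_apply]
  push_cast; ring

end Spectral

/-! ### Lower bound by iterated differences -/

section LowerBound

variable {d : ℕ}

lemma norm_planeWave_sub_one_le_two (x ξ : Eucl d) : ‖planeWave x ξ - 1‖ ≤ 2 := by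
  refine (norm_sub_le _ _).trans ?_
  rw [norm_planeWave, norm_one]; norm_num

lemma norm_planeWave_sub_one_le (x ξ : Eucl d) :
    ‖planeWave x ξ - 1‖ ≤ 2 * Real.pi * (‖ξ‖ * ‖x‖) := by
  rw [planeWave, mul_comm]
  refine Real.norm_exp_I_mul_ofReal_sub_one_le.trans ?_
  rw [norm_mul, Real.norm_of_nonneg (by positivity)]
  gcongr
  exact norm_inner_le_norm ξ x

/-- Binomial expansion of a power of a difference of plane waves. -/
lemma sum_choose_mul_planeWave (n : ℕ) (x ξ : Eucl d) :
    ∑ j ∈ Finset.range (n + 1), (((-1) ^ (n - j) * (n.choose j : ℝ) : ℝ) : ℂ) *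
      planeWave ((j : ℝ) • x) ξ = (planeWave x ξ - 1) ^ n := by
  rw [sub_eq_add_neg, add_pow]
  refine Finset.sum_congr rfl fun j _ => ?_
  rw [planeWave_natCast_smul]
  push_cast; ring

/-- Used with `s = |e_x - 1|` and `t = r‖ξ‖`. For `t ≤ 1`, `s ≤ 2πt` and `t^(2n) ≤ t^β`; for `t ≥
1`, `s ≤ 2 ≤ 2π` and `1 + t ≤ 2t`. -/
lemma min_pow_mul_one_add_rpow_le {β t s : ℝ} {n : ℕ} (hβ : 0 ≤ β) (hn : β ≤ 2 * n) (ht : 0 ≤ t)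
    (hs0 : 0 ≤ s) (hs2 : s ≤ 2) (hst : s ≤ 2 * Real.pi * t) :
    s ^ (2 * n) * (1 + t) ^ β ≤ (2 * Real.pi) ^ (2 * n) * 2 ^ β * t ^ β := by
  have hpi : 1 ≤ Real.pi := by linarith [Real.pi_gt_three]
  rcases le_total t 1 with h | h
  · have h1 : s ^ (2 * n) ≤ (2 * Real.pi) ^ (2 * n) * t ^ β := by
      calc s ^ (2 * n) ≤ (2 * Real.pi * t) ^ (2 * n) := by gcongr
        _ = (2 * Real.pi) ^ (2 * n) * t ^ (((2 * n : ℕ) : ℝ)) := by rw [mul_pow, Real.rpow_natCast]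
        _ ≤ (2 * Real.pi) ^ (2 * n) * t ^ β := by
          gcongr _ * ?_
          rcases ht.eq_or_lt with rfl | ht
          · rcases hβ.eq_or_lt with rfl | hβ
            · rw [Real.rpow_zero]
              exact Real.rpow_le_one le_rfl zero_le_one (by positivity)
            · rw [Real.zero_rpow hβ.ne', Real.zero_rpow]
              push_cast; linarith
          · exact Real.rpow_le_rpow_of_exponent_ge ht h (by push_cast; exact hn)
    calc s ^ (2 * n) * (1 + t) ^ β ≤ ((2 * Real.pi) ^ (2 * n) * t ^ β) * 2 ^ β := by
          gcongr; linarith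
      _ = _ := by ring
  · calc s ^ (2 * n) * (1 + t) ^ β ≤ (2 * Real.pi) ^ (2 * n) * (2 * t) ^ β := by
          gcongr <;> linarith
      _ = _ := by rw [Real.mul_rpow zero_le_two ht]; ring

lemma finrank_eucl : Module.finrank ℝ (Eucl d) = d := by simp

variable {H : Type*} [NormedAddCommGroup H] [InnerProductSpace ℝ H] [CompleteSpace H]
    [RKHS ℝ H (Eucl d) ℝ]

/-- Testing a bump function against an iterated difference of kernel functions whose nodes, except
for the origin, lie outside of the support. -/
lemma HasSpectralDensity.one_le_norm_sq_mul_integral {φ : Eucl d → ℝ} (hφ : HasSpectralDensity H φ)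
    {r : ℝ} {b : H} (hb : b ∈ bumpSet H r) {x : Eucl d} (hr : 0 ≤ r) (hx : ‖x‖ = r) (n : ℕ) :
    1 ≤ ‖b‖ ^ 2 * ∫ ξ, φ ξ * ‖planeWave x ξ - 1‖ ^ (2 * n) := by
  set u := ∑ j ∈ Finset.range (n + 1), ((-1) ^ (n - j) * (n.choose j : ℝ)) •
    RKHS.kerFun H ((j : ℝ) • x) 1 with hu
  have hsq : ‖u‖ ^ 2 = ∫ ξ, φ ξ * ‖planeWave x ξ - 1‖ ^ (2 * n) := by
    rw [hu, hφ.norm_sq_sum]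
    simp_rw [sum_choose_mul_planeWave, norm_pow, ← pow_mul, mul_comm n 2]
  have hinner : inner ℝ b u = (-1) ^ n := by
    rw [hu, inner_sum, Finset.sum_range_succ']
    simp only [real_inner_smul_right, inner_kerFun_one]
    -- After splitting off `j = 0`, the nodes are `(j + 1)x`, of norm at least `r`, where `b`
    -- vanishes.
    rw [Finset.sum_eq_zero fun j _ => ?_]
    · simp [hb.1]
    · rw [hb.2, mul_zero]
      rw [norm_smul, hx, Real.norm_natCast]
      push_cast
      nlinarith [(Nat.cast_nonneg j : (0 : ℝ) ≤ j)]
  have h1 : 1 ≤ ‖b‖ * ‖u‖ := by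
    have := abs_real_inner_le_norm b u
    rwa [hinner, abs_pow, abs_neg, abs_one, one_pow] at this
  rw [← hsq, ← mul_pow]
  exact one_le_pow₀ h1

lemma integral_comp_smul_eucl {F : Type*} [NormedAddCommGroup F] [NormedSpace ℝ F]
    (f : Eucl d → F) {r : ℝ} (hr : 0 < r) :
    ∫ ξ, f (r • ξ) = r ^ (-(d : ℝ)) • ∫ ξ, f ξ := by
  rw [Measure.integral_comp_smul_of_nonneg _ _ _ (hR := hr.le), finrank_eucl,
    Real.rpow_neg hr.le, Real.rpow_natCast]

/-- The norm of a bump function of support radius `r` is at least of order `r ^ (d / 2 - β / 2)`. -/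
theorem HasSpectralDensity.exists_le_norm_of_mem_bumpSet (hd : 0 < d) {φ : Eucl d → ℝ}
    (hφ : HasSpectralDensity H φ) {β C : ℝ} (hβ : (d : ℝ) < β)  (hC : 0 < C)
    (hupper : ∀ᵐ ξ : Eucl d, φ ξ ≤ C * (1 + ‖ξ‖ ^ β)⁻¹) :
    ∃ D : ℝ, 0 < D ∧ ∀ r : ℝ, 0 < r → ∀ b ∈ bumpSet H r,
      r ^ ((d : ℝ) / 2 - β / 2) ≤ D * ‖b‖ := by
  have hβ0 : 0 < β := (Nat.cast_nonneg d).trans_lt hβ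
  obtain ⟨n, hn⟩ := exists_nat_ge (β / 2)
  have hn : β ≤ 2 * n := by linarith
  set A : ℝ := (2 * Real.pi) ^ (2 * n) * 2 ^ β with hA
  have hA0 : 0 < A := by positivity
  have hint : Integrable fun η : Eucl d => (1 + ‖η‖) ^ (-β) :=
    integrable_one_add_norm (by rwa [finrank_eucl])
  set J : ℝ := ∫ η : Eucl d, (1 + ‖η‖) ^ (-β) with hJ
  have hJ0 : 0 ≤ J := integral_nonneg fun η => by positivity
  refine ⟨Real.sqrt (C * A * J) + 1, by positivity, fun r hr b hb => ?_⟩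
  let x : Eucl d := EuclideanSpace.single ⟨0, hd⟩ r
  have hx : ‖x‖ = r := by simp [x, abs_of_pos hr]
  have h1 := hφ.one_le_norm_sq_mul_integral hb hr.le hx n
  have hpt : ∀ᵐ ξ : Eucl d, φ ξ * ‖planeWave x ξ - 1‖ ^ (2 * n) ≤
      C * A * r ^ β * (1 + ‖r • ξ‖) ^ (-β) := by
    filter_upwards [hupper] with ξ hξ
    have ht : ‖r • ξ‖ = r * ‖ξ‖ := by rw [norm_smul, Real.norm_of_nonneg hr.le]
    have h2 := min_pow_mul_one_add_rpow_le hβ0.le hn (norm_nonneg (r • ξ))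
      (norm_nonneg (planeWave x ξ - 1)) (norm_planeWave_sub_one_le_two x ξ)
      ((norm_planeWave_sub_one_le x ξ).trans_eq (by rw [hx, ht]; ring))
    rw [← hA] at h2
    have h3 : ‖planeWave x ξ - 1‖ ^ (2 * n) ≤ A * (r ^ β * ‖ξ‖ ^ β) * (1 + ‖r • ξ‖) ^ (-β) := by
      rw [Real.rpow_neg (by positivity), ← div_eq_mul_inv, le_div_iff₀ (by positivity)]
      refine h2.trans_eq ?_
      rw [ht, Real.mul_rpow hr.le (norm_nonneg _)]
    -- The decay of `φ` absorbs `‖ξ‖^β`, leaving the factor `r^β`.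
    have h4 : (1 + ‖ξ‖ ^ β)⁻¹ * ‖ξ‖ ^ β ≤ 1 := by
      rw [inv_mul_le_iff₀ (by positivity)]
      linarith
    calc φ ξ * ‖planeWave x ξ - 1‖ ^ (2 * n)
        ≤ C * (1 + ‖ξ‖ ^ β)⁻¹ * (A * (r ^ β * ‖ξ‖ ^ β) * (1 + ‖r • ξ‖) ^ (-β)) := by gcongr
      _ = C * A * r ^ β * (1 + ‖r • ξ‖) ^ (-β) * ((1 + ‖ξ‖ ^ β)⁻¹ * ‖ξ‖ ^ β) := by ring
      _ ≤ C * A * r ^ β * (1 + ‖r • ξ‖) ^ (-β) * 1 := by gcongr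
      _ = _ := mul_one _
  have hle : ∫ ξ, φ ξ * ‖planeWave x ξ - 1‖ ^ (2 * n) ≤ C * A * J * r ^ (β - d) := by
    calc ∫ ξ, φ ξ * ‖planeWave x ξ - 1‖ ^ (2 * n)
        ≤ ∫ ξ : Eucl d, C * A * r ^ β * (1 + ‖r • ξ‖) ^ (-β) := by
          refine integral_mono_ae ?_ ((hint.comp_smul hr.ne').const_mul _) hpt
          refine hφ.1.mul_bdd (c := 2 ^ (2 * n)) (by fun_prop) (ae_of_all _ fun ξ => ?_)
          rw [Real.norm_of_nonneg (by positivity)]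
          gcongr
          exact norm_planeWave_sub_one_le_two x ξ
      _ = _ := by
          rw [integral_const_mul, integral_comp_smul_eucl (fun η => (1 + ‖η‖) ^ (-β)) hr, ← hJ,
            sub_eq_add_neg, Real.rpow_add hr, smul_eq_mul]
          ring
  have h5 : 1 ≤ ‖b‖ ^ 2 * (C * A * J * r ^ (β - d)) := h1.trans (by gcongr)
  have h6 : r ^ ((d : ℝ) - β) ≤ ‖b‖ ^ 2 * (C * A * J) := by
    rw [← neg_sub, Real.rpow_neg hr.le, inv_le_iff_one_le_mul₀ (by positivity)]
    linarith
  have h7 : r ^ ((d : ℝ) / 2 - β / 2) = Real.sqrt (r ^ ((d : ℝ) - β)) := by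
    rw [Real.sqrt_eq_rpow, ← Real.rpow_mul hr.le]; congr 1; ring
  rw [h7]
  calc Real.sqrt (r ^ ((d : ℝ) - β)) ≤ Real.sqrt (‖b‖ ^ 2 * (C * A * J)) := Real.sqrt_le_sqrt h6
    _ = Real.sqrt (C * A * J) * ‖b‖ := by
      rw [Real.sqrt_mul (by positivity), Real.sqrt_sq (norm_nonneg b), mul_comm]
    _ ≤ _ := by gcongr; linarith

end LowerBound

/-! ### Upper bound by dilating a smooth bump -/

section UpperBound

variable {d : ℕ} {H : Type*} [NormedAddCommGroup H] [InnerProductSpace ℝ H] [CompleteSpace H]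
    [RKHS ℝ H (Eucl d) ℝ]

/-- A function whose Fourier transform is square integrable with weight `φ⁻¹` belongs to the space
with spectral density `φ`. -/
lemma HasSpectralDensity.exists_eq_of_integrable {φ : Eucl d → ℝ} (hφ : HasSpectralDensity H φ)
    (hpos : ∀ᵐ ξ, 0 < φ ξ) {f : Eucl d → ℝ} {h : Eucl d → ℂ} (hh : Integrable h)
    (hf : ∀ x, (f x : ℂ) = 𝓕⁻ h x) (hint : Integrable fun ξ => ‖h ξ‖ ^ 2 / φ ξ) :
    ∃ b : H, ‖b‖ ≤ Real.sqrt (∫ ξ, ‖h ξ‖ ^ 2 / φ ξ) ∧ ∀ x, b x = f x := by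
  suffices hle : ∀ c : Eucl d →₀ ℝ, |Finsupp.linearCombination ℝ f c| ≤
      Real.sqrt (∫ ξ, ‖h ξ‖ ^ 2 / φ ξ) *
        ‖Finsupp.linearCombination ℝ (fun x => RKHS.kerFun H x 1) c‖ by
    obtain ⟨b, hb, hbf⟩ := exists_inner_eq_of_abs_le _ _ (Real.sqrt_nonneg _) hle
    refine ⟨b, hb, fun x => ?_⟩
    have := hbf (Finsupp.single x 1)
    rwa [Finsupp.linearCombination_single, Finsupp.linearCombination_single, one_smul, one_smul,
      inner_kerFun_one] at this
  intro c
  simp only [Finsupp.linearCombination_apply, Finsupp.sum]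
  set P : Eucl d → ℂ := fun ξ => ∑ x ∈ c.support, (c x : ℂ) * planeWave x ξ with hP
  have hPc : Continuous P := by fun_prop
  have hPb : ∀ ξ, ‖P ξ‖ ≤ ∑ x ∈ c.support, ‖c x‖ := fun ξ => by
    refine (norm_sum_le _ _).trans (Finset.sum_le_sum fun x _ => ?_)
    rw [norm_mul, norm_planeWave, mul_one, Complex.norm_real]
  have h1 : ((∑ x ∈ c.support, c x • f x : ℝ) : ℂ) = ∫ ξ, P ξ * h ξ := by
    simp only [hP, Finset.sum_mul, mul_assoc]
    rw [integral_finsetSum _ fun x _ => (hh.planeWave_mul x).const_mul _]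
    push_cast
    simp only [integral_const_mul, ← fourierInv_eq_integral_planeWave, ← hf, smul_eq_mul,
      Complex.ofReal_mul]
  have h2 : ‖∑ x ∈ c.support, c x • RKHS.kerFun H x 1‖ = Real.sqrt (∫ ξ, φ ξ * ‖P ξ‖ ^ 2) := by
    have := hφ.norm_sq_sum c.support c id
    simp only [id_eq] at this
    rw [hP, ← this, Real.sqrt_sq (norm_nonneg _)]
  have hφm := hφ.1.aestronglyMeasurable
  have m1 : MemLp (fun ξ => ‖h ξ‖ / Real.sqrt (φ ξ)) (ENNReal.ofReal 2) := by
    rw [ENNReal.ofReal_ofNat, memLp_two_iff_integrable_sq]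
    · refine hint.congr ?_
      filter_upwards [hpos] with ξ hξ
      rw [div_pow, Real.sq_sqrt hξ.le]
    · exact (hh.aestronglyMeasurable.norm.aemeasurable.div
        hφm.aemeasurable.sqrt).aestronglyMeasurable
  have hφP : Integrable fun ξ => φ ξ * ‖P ξ‖ ^ 2 := by
    refine hφ.1.mul_bdd (c := (∑ x ∈ c.support, ‖c x‖) ^ 2) (by fun_prop)
      (ae_of_all _ fun ξ => ?_)
    rw [Real.norm_of_nonneg (by positivity)]
    gcongr
    exact hPb ξ
  have m2 : MemLp (fun ξ => Real.sqrt (φ ξ) * ‖P ξ‖) (ENNReal.ofReal 2) := by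
    rw [ENNReal.ofReal_ofNat, memLp_two_iff_integrable_sq]
    · refine hφP.congr ?_
      filter_upwards [hpos] with ξ hξ
      rw [mul_pow, Real.sq_sqrt hξ.le]
    · exact (hφm.aemeasurable.sqrt.mul hPc.norm.measurable.aemeasurable).aestronglyMeasurable
  -- Cauchy–Schwarz for `|P h| = (|h|/√φ)(√φ |P|)`; the second factor has `L²` norm `‖∑ c_x k_x‖`.
  have hCS := integral_mul_le_Lp_mul_Lq_of_nonneg Real.HolderConjugate.two_two
    (ae_of_all _ fun ξ => by positivity) (ae_of_all _ fun ξ => by positivity) m1 m2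
  rw [h2, ← Real.norm_eq_abs, ← Complex.norm_real, h1]
  calc ‖∫ ξ, P ξ * h ξ‖ ≤ ∫ ξ, ‖P ξ * h ξ‖ := norm_integral_le_integral_norm _
    _ = ∫ ξ, ‖h ξ‖ / Real.sqrt (φ ξ) * (Real.sqrt (φ ξ) * ‖P ξ‖) := by
      refine integral_congr_ae ?_
      filter_upwards [hpos] with ξ hξ
      have := (Real.sqrt_pos.2 hξ).ne'
      rw [norm_mul]; field_simp
    _ ≤ _ := hCS
    _ = _ := by
      rw [Real.sqrt_eq_rpow, Real.sqrt_eq_rpow]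
      congr 2
      · refine integral_congr_ae ?_
        filter_upwards [hpos] with ξ hξ
        rw [Real.rpow_two, div_pow, Real.sq_sqrt hξ.le]
      · refine integral_congr_ae ?_
        filter_upwards [hpos] with ξ hξ
        rw [Real.rpow_two, mul_pow, Real.sq_sqrt hξ.le]

/-- A smooth bump function supported in the unit ball, as the inverse Fourier transform of a
Schwartz function. -/
lemma exists_schwartz_bump (d : ℕ) : ∃ (f : Eucl d → ℝ) (h : 𝓢(Eucl d, ℂ)),
    f 0 = 1 ∧ (∀ x, 1 ≤ ‖x‖ → f x = 0) ∧ ∀ x, (f x : ℂ) = 𝓕⁻ (h : Eucl d → ℂ) x := by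
  let g : ContDiffBump (0 : Eucl d) := ⟨1 / 2, 1, by norm_num, by norm_num⟩
  have hs : HasCompactSupport fun x => (g x : ℂ) :=
    g.hasCompactSupport.comp_left (g := Complex.ofReal) Complex.ofReal_zero
  have hc : ContDiff ℝ (⊤ : ℕ∞) fun x => (g x : ℂ) := Complex.ofRealCLM.contDiff.comp g.contDiff
  refine ⟨g, 𝓕 (hs.toSchwartzMap hc), ?_, fun x hx => ?_, fun x => ?_⟩
  · exact g.one_of_mem_closedBall (by simp [g])
  · exact g.zero_of_le_dist (by simpa using hx)
  · rw [← SchwartzMap.fourierInv_coe, FourierTransform.fourierInv_fourier_eq]; rfl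

lemma SchwartzMap.integrable_norm_sq_mul_one_add_rpow (h : 𝓢(Eucl d, ℂ)) {β : ℝ} (hβ : 0 ≤ β) :
    Integrable fun ξ => ‖h ξ‖ ^ 2 * (1 + ‖ξ‖ ^ β) := by
  obtain ⟨M, hM0, hM⟩ := h.decay 0 0
  have hM : ∀ ξ, ‖h ξ‖ ≤ M := fun ξ => by simpa using hM ξ
  obtain ⟨k, hk⟩ := exists_nat_ge β
  have hm : Integrable fun ξ => M * (2 * ‖h ξ‖ + ‖ξ‖ ^ k * ‖h ξ‖) :=
    ((h.integrable.norm.const_mul 2).add (h.integrable_pow_mul volume k)).const_mul M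
  have hc : Continuous fun ξ : Eucl d => ‖ξ‖ ^ β := continuous_norm.rpow_const fun _ => .inr hβ
  refine hm.mono' ((h.continuous.norm.pow 2).mul (continuous_const.add hc)).aestronglyMeasurable
    (ae_of_all _ fun ξ => ?_)
  have h1 : ‖ξ‖ ^ β ≤ 1 + ‖ξ‖ ^ k := by
    rcases le_total ‖ξ‖ 1 with h | h
    · exact (Real.rpow_le_one (norm_nonneg _) h hβ).trans (by simp)
    · have := Real.rpow_le_rpow_of_exponent_le h hk
      rw [Real.rpow_natCast] at this
      linarith
  rw [Real.norm_of_nonneg (by positivity)]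
  calc ‖h ξ‖ ^ 2 * (1 + ‖ξ‖ ^ β) = ‖h ξ‖ * (‖h ξ‖ * (1 + ‖ξ‖ ^ β)) := by ring
    _ ≤ M * (‖h ξ‖ * (1 + (1 + ‖ξ‖ ^ k))) := by gcongr; exact hM ξ
    _ = _ := by ring

/-- There are bump functions of support radius `r` with norm of order `r ^ (d / 2 - β / 2)`. -/
theorem HasSpectralDensity.exists_mem_bumpSet_norm_le {φ : Eucl d → ℝ}
    (hφ : HasSpectralDensity H φ) {β c : ℝ} (hβ : 0 ≤ β) (hc : 0 < c)
    (hlower : ∀ᵐ ξ : Eucl d, c * (1 + ‖ξ‖ ^ β)⁻¹ ≤ φ ξ) :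
    ∃ D : ℝ, 0 < D ∧ ∀ r : ℝ, 0 < r → r ≤ 1 → ∃ b ∈ bumpSet H r,
      ‖b‖ ≤ D * r ^ ((d : ℝ) / 2 - β / 2) := by
  obtain ⟨f, h, hf0, hf1, hfh⟩ := exists_schwartz_bump d
  have hpos : ∀ᵐ ξ, 0 < φ ξ := by
    filter_upwards [hlower] with ξ hξ
    exact lt_of_lt_of_le (by positivity) hξ
  set g : Eucl d → ℝ := fun ξ => ‖h ξ‖ ^ 2 * (1 + ‖ξ‖ ^ β) with hg
  have hgi : Integrable g := h.integrable_norm_sq_mul_one_add_rpow hβ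
  have hJ0 : 0 ≤ ∫ ξ, g ξ := integral_nonneg fun ξ => by positivity
  refine ⟨Real.sqrt (c⁻¹ * ∫ ξ, g ξ) + 1, by positivity, fun r hr hr1 => ?_⟩
  have hrd : 0 < r ^ (d : ℝ) := Real.rpow_pos_of_pos hr _
  set hr' : Eucl d → ℂ := fun ξ => ((r ^ (d : ℝ) : ℝ) : ℂ) * h (r • ξ) with hhr
  have hri : Integrable hr' := (h.integrable.comp_smul hr.ne').const_mul _
  have hfr : ∀ x, ((f (r⁻¹ • x) : ℝ) : ℂ) = 𝓕⁻ hr' x := fun x => by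
    rw [hfh, fourierInv_eq_integral_planeWave, fourierInv_eq_integral_planeWave]
    have h1 : ∀ ξ, planeWave x ξ * hr' ξ =
        ((r ^ (d : ℝ) : ℝ) : ℂ) * (planeWave (r⁻¹ • x) (r • ξ) * h (r • ξ)) := fun ξ => by
      rw [planeWave_smul, inv_smul_smul₀ hr.ne']; ring
    simp_rw [h1]
    rw [integral_const_mul, integral_comp_smul_eucl (fun η => planeWave (r⁻¹ • x) η * h η) hr,
      Complex.real_smul, ← mul_assoc, ← Complex.ofReal_mul, ← Real.rpow_add hr]
    simp
  have hbd : ∀ᵐ ξ, ‖hr' ξ‖ ^ 2 / φ ξ ≤ c⁻¹ * (r ^ (d : ℝ)) ^ 2 * r ^ (-β) * g (r • ξ) := by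
    filter_upwards [hlower, hpos] with ξ hξ hξ0
    have h1 : (φ ξ)⁻¹ ≤ c⁻¹ * (1 + ‖ξ‖ ^ β) := by
      rw [inv_le_comm₀ hξ0 (by positivity), mul_inv, inv_inv]
      exact hξ
    -- This is where `r ≤ 1` enters, through `1 ≤ r^(-β)`.
    have h2 : 1 + ‖ξ‖ ^ β ≤ r ^ (-β) * (1 + ‖r • ξ‖ ^ β) := by
      rw [norm_smul, Real.norm_of_nonneg hr.le, Real.mul_rpow hr.le (norm_nonneg _), mul_add,
        ← mul_assoc, ← Real.rpow_add hr, neg_add_cancel, Real.rpow_zero, mul_one, one_mul]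
      have := Real.one_le_rpow_of_pos_of_le_one_of_nonpos hr hr1 (neg_nonpos.2 hβ)
      linarith
    calc ‖hr' ξ‖ ^ 2 / φ ξ = (r ^ (d : ℝ)) ^ 2 * ‖h (r • ξ)‖ ^ 2 * (φ ξ)⁻¹ := by
          rw [hhr, norm_mul, Complex.norm_real, Real.norm_of_nonneg hrd.le, mul_pow,
            div_eq_mul_inv]
      _ ≤ (r ^ (d : ℝ)) ^ 2 * ‖h (r • ξ)‖ ^ 2 * (c⁻¹ * (r ^ (-β) * (1 + ‖r • ξ‖ ^ β))) := by
          gcongr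
          exact h1.trans (by gcongr)
      _ = _ := by simp only [hg]; ring
  have hmaj : Integrable fun ξ => c⁻¹ * (r ^ (d : ℝ)) ^ 2 * r ^ (-β) * g (r • ξ) :=
    (hgi.comp_smul hr.ne').const_mul _
  have hint : Integrable fun ξ => ‖hr' ξ‖ ^ 2 / φ ξ := by
    refine hmaj.mono' ((hri.aestronglyMeasurable.norm.aemeasurable.pow_const 2).div
      hφ.1.aestronglyMeasurable.aemeasurable).aestronglyMeasurable ?_
    filter_upwards [hbd, hpos] with ξ hξ hξ0
    rwa [Real.norm_of_nonneg (by positivity)]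
  obtain ⟨b, hb, hbf⟩ := hφ.exists_eq_of_integrable hpos hri hfr hint
  refine ⟨b, ⟨by rw [hbf, smul_zero, hf0], fun y hy => ?_⟩, ?_⟩
  · rw [hbf, hf1]
    rwa [norm_smul, norm_inv, Real.norm_of_nonneg hr.le, le_inv_mul_iff₀ hr, mul_one]
  · have hle : ∫ ξ, ‖hr' ξ‖ ^ 2 / φ ξ ≤ c⁻¹ * (∫ ξ, g ξ) * r ^ ((d : ℝ) - β) := by
      refine (integral_mono_ae hint hmaj hbd).trans_eq ?_
      rw [integral_const_mul, integral_comp_smul_eucl g hr, smul_eq_mul, sub_eq_add_neg,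
        Real.rpow_add hr, Real.rpow_neg hr.le (d : ℝ)]
      field_simp
    have h7 : r ^ ((d : ℝ) / 2 - β / 2) = Real.sqrt (r ^ ((d : ℝ) - β)) := by
      rw [Real.sqrt_eq_rpow, ← Real.rpow_mul hr.le]; congr 1; ring
    calc ‖b‖ ≤ Real.sqrt (c⁻¹ * (∫ ξ, g ξ) * r ^ ((d : ℝ) - β)) := hb.trans (Real.sqrt_le_sqrt hle)
      _ = Real.sqrt (c⁻¹ * ∫ ξ, g ξ) * r ^ ((d : ℝ) / 2 - β / 2) := by
        rw [Real.sqrt_mul (by positivity), h7]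
      _ ≤ _ := by gcongr; linarith

end UpperBound

/-! ### Asymptotics from a spectral density -/

section Bump

variable {d : ℕ}

lemma bumpSet_mono {F : Type*} [FunLike F (Eucl d) ℝ] {r s : ℝ} (hrs : r ≤ s) :
    bumpSet F r ⊆ bumpSet F s :=
  fun _ hb => ⟨hb.1, fun y hy => hb.2 y (hrs.trans hy)⟩

variable {H : Type*} [NormedAddCommGroup H] [InnerProductSpace ℝ H] [CompleteSpace H]
    [RKHS ℝ H (Eucl d) ℝ]

/-- Minimal bump functions in a reproducing kernel Hilbert space with spectral density of order
`(1 + ‖ξ‖ ^ β)⁻¹`. -/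
theorem HasSpectralDensity.bump_asymptotics (hd : 0 < d) {φ : Eucl d → ℝ}
    (hφ : HasSpectralDensity H φ) {β c C : ℝ} (hβ : (d : ℝ) < β) (hc : 0 < c) (hC : 0 < C)
    (hbd : ∀ᵐ ξ : Eucl d, c * (1 + ‖ξ‖ ^ β)⁻¹ ≤ φ ξ ∧ φ ξ ≤ C * (1 + ‖ξ‖ ^ β)⁻¹) :
    (∀ r : ℝ, 0 < r → ∃! b : H, IsNormMinimalBump r b) ∧
      (fun r => bumpNorm H r) =Θ[𝓝[>] (0 : ℝ)] fun r => r ^ ((d : ℝ) / 2 - β / 2) := by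
  obtain ⟨D₁, hD₁, hlow⟩ := hφ.exists_le_norm_of_mem_bumpSet hd hβ hC (hbd.mono fun _ h => h.2)
  obtain ⟨D₂, hD₂, hup⟩ := hφ.exists_mem_bumpSet_norm_le ((Nat.cast_nonneg d).trans hβ.le) hc
    (hbd.mono fun _ h => h.1)
  have hmin : ∀ r : ℝ, 0 < r → ∃! b : H, IsNormMinimalBump r b := fun r hr => by
    -- The construction covers only radii up to `1`; a smaller bump also serves for larger `r`.
    obtain ⟨b, hb, -⟩ := hup (min r 1) (lt_min hr one_pos) (min_le_right _ _)
    exact existsUnique_isNormMinimalBump ⟨b, bumpSet_mono (min_le_left _ _) hb⟩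
  have hmem : ∀ᶠ r : ℝ in 𝓝[>] 0, 0 < r ∧ r ≤ 1 := by
    filter_upwards [Ioc_mem_nhdsGT one_pos] with r hr using hr
  refine ⟨hmin, IsBigO.of_bound D₂ ?_, IsBigO.of_bound D₁ ?_⟩
  · filter_upwards [hmem] with r ⟨hr, hr1⟩
    obtain ⟨b, hb, hbn⟩ := (hmin r hr).exists
    obtain ⟨b', hb', hle⟩ := hup r hr hr1
    rw [Real.norm_of_nonneg (hbn ▸ norm_nonneg b), Real.norm_of_nonneg (by positivity)]
    exact (bumpNorm_le hb').trans hle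
  · filter_upwards [hmem] with r ⟨hr, hr1⟩
    obtain ⟨b, hb, hbn⟩ := (hmin r hr).exists
    rw [Real.norm_of_nonneg (by positivity), Real.norm_of_nonneg (hbn ▸ norm_nonneg b), ← hbn]
    exact hlow r hr b hb

end Bump

/-! ### Fourier inversion for integrable transforms -/

section FourierInversion

variable {d : ℕ}

/-- The inverse Fourier transform of an integrable function is self-adjoint. -/
lemma integral_fourierInv_mul_eq_of_integrable {h g : Eucl d → ℂ} (hh : Integrable h)
    (hg : Integrable g) : ∫ x, 𝓕⁻ h x * g x = ∫ ξ, h ξ * 𝓕⁻ g ξ := by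
  have := VectorFourier.integral_fourierIntegral_smul_eq_flip (μ := volume) (ν := volume)
    (L := -innerₗ (Eucl d)) Real.continuous_fourierChar (by simp; fun_prop) hh hg
  have hflip : (-innerₗ (Eucl d)).flip = -innerₗ (Eucl d) := by
    ext x y; simp [real_inner_comm]
  rw [hflip] at this
  exact this

lemma continuous_fourierInv_of_integrable {h : Eucl d → ℂ} (hh : Integrable h) :
    Continuous (𝓕⁻ h) :=
  VectorFourier.fourierIntegral_continuous Real.continuous_fourierChar
    (L := -innerₗ (Eucl d)) (by simp; fun_prop) hh

/-- If `h` is the distributional Fourier transform of `f` and `h` is integrable, then `f` is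
the inverse Fourier transform of `h`. -/
lemma ae_eq_fourierInv_of_forall_schwartz {f h : Eucl d → ℂ} (hf : LocallyIntegrable f)
    (hh : Integrable h) (hfh : ∀ ψ : 𝓢(Eucl d, ℂ), ∫ x, f x * ψ x = ∫ ξ, h ξ * (𝓕⁻ ψ) ξ) :
    f =ᵐ[volume] 𝓕⁻ h := by
  refine ae_eq_of_integral_contDiff_smul_eq hf
    (continuous_fourierInv_of_integrable hh).locallyIntegrable fun g hg hgs => ?_
  have hs : HasCompactSupport fun x => (g x : ℂ) :=
    hgs.comp_left (g := Complex.ofReal) Complex.ofReal_zero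
  have hc : ContDiff ℝ (⊤ : ℕ∞) fun x => (g x : ℂ) := Complex.ofRealCLM.contDiff.comp hg
  set ψ : 𝓢(Eucl d, ℂ) := hs.toSchwartzMap hc
  have hψ : ∀ x, ψ x = (g x : ℂ) := fun x => rfl
  simp_rw [Complex.real_smul, ← hψ, mul_comm (ψ _)]
  rw [hfh, integral_fourierInv_mul_eq_of_integrable hh ψ.integrable, SchwartzMap.fourierInv_coe]

/-- An integrable function with vanishing inverse Fourier transform vanishes. -/
lemma ae_eq_zero_of_fourierInv_eq_zero {h : Eucl d → ℂ} (hh : Integrable h)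
    (h0 : ∀ x, 𝓕⁻ h x = 0) : h =ᵐ[volume] 0 := by
  have h1 : ∀ g : 𝓢(Eucl d, ℂ), ∫ ξ, h ξ * g ξ = 0 := fun g => by
    have := integral_fourierInv_mul_eq_of_integrable hh (𝓕 g).integrable
    rw [← SchwartzMap.fourierInv_coe, FourierTransform.fourierInv_fourier_eq] at this
    simpa [h0] using this.symm
  -- Here `h` plays the original function, and its distributional transform is `0`.
  have := ae_eq_fourierInv_of_forall_schwartz hh.locallyIntegrable
    (integrable_zero (Eucl d) ℂ volume) fun ψ => by rw [h1]; simp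
  refine this.trans (ae_of_all _ fun x => ?_)
  simp [fourierInv_eq_integral_planeWave]

/-- The inverse `L²` Fourier transform is given by the usual integral on `L¹ ∩ L²`. -/
lemma Lp_fourierInv_ae_eq_of_integrable (h : Lp ℂ 2 (volume : Measure (Eucl d)))
    (hh : Integrable h) :
    ((𝓕⁻ h : Lp ℂ 2 (volume : Measure (Eucl d))) : Eucl d → ℂ) =ᵐ[volume]
      𝓕⁻ (h : Eucl d → ℂ) := by
  refine ae_eq_fourierInv_of_forall_schwartz ((Lp.memLp _).locallyIntegrable (by norm_num)) hh
    fun ψ => ?_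
  have := congrArg (fun T : 𝓢'(Eucl d, ℂ) => T ψ) (Lp.fourierInv_toTemperedDistribution_eq h)
  simp only [TemperedDistribution.fourierInv_apply, Lp.toTemperedDistribution_apply,
    smul_eq_mul] at this
  simp_rw [mul_comm _ (ψ _), mul_comm _ ((𝓕⁻ ψ) _)]
  exact this.symm

end FourierInversion

/-! ### Native spaces of kernels with algebraic decay -/

section AlgebraicDecay

variable {d : ℕ}

lemma integrable_of_ae_le_inv_one_add_rpow {φ : Eucl d → ℝ} {β C : ℝ} (hβ : (d : ℝ) < β)
    (hm : AEStronglyMeasurable φ) (h0 : ∀ᵐ ξ, 0 ≤ φ ξ)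
    (hle : ∀ᵐ ξ, φ ξ ≤ C * (1 + ‖ξ‖ ^ β)⁻¹) : Integrable φ := by
  have hβ0 : 0 < β := (Nat.cast_nonneg d).trans_lt hβ
  have hint : Integrable fun η : Eucl d => |C| * (2 ^ β * (1 + ‖η‖) ^ (-β)) :=
    ((integrable_one_add_norm (by rwa [finrank_eucl])).const_mul _).const_mul _
  refine hint.mono' hm ?_
  filter_upwards [h0, hle] with ξ h0 hle
  rw [Real.norm_of_nonneg h0]
  refine hle.trans ?_
  have h1 : (1 + ‖ξ‖) ^ β ≤ 2 ^ β * (1 + ‖ξ‖ ^ β) := by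
    rcases le_total ‖ξ‖ 1 with h | h
    · calc (1 + ‖ξ‖) ^ β ≤ 2 ^ β := by gcongr; linarith
        _ ≤ 2 ^ β * (1 + ‖ξ‖ ^ β) := le_mul_of_one_le_right (by positivity)
          (by linarith [Real.rpow_nonneg (norm_nonneg ξ) β])
    · calc (1 + ‖ξ‖) ^ β ≤ (2 * ‖ξ‖) ^ β := by gcongr; linarith
        _ = 2 ^ β * ‖ξ‖ ^ β := Real.mul_rpow zero_le_two (norm_nonneg _)
        _ ≤ _ := by gcongr; linarith
  have h2 : (1 + ‖ξ‖ ^ β)⁻¹ ≤ 2 ^ β * (1 + ‖ξ‖) ^ (-β) := by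
    rw [Real.rpow_neg (by positivity), inv_le_iff_one_le_mul₀ (by positivity), mul_right_comm,
      ← div_eq_mul_inv, one_le_div (by positivity)]
    exact h1
  exact mul_le_mul (le_abs_self C) h2 (by positivity) (abs_nonneg C)

/-- The native space of a kernel with algebraically decaying Fourier transform has this transform as
its spectral density. -/
lemma HasFourierTransform.hasSpectralDensity {K : Eucl d → Eucl d → ℝ}
    (hK : IsTranslationInvariantKernel K) {φ : Eucl d → ℝ}
    (hφ : HasFourierTransform (fun x => K x 0) φ) (hint : Integrable φ)
    {H : Type*} [NormedAddCommGroup H] [InnerProductSpace ℝ H] [CompleteSpace H]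
    [RKHS ℝ H (Eucl d) ℝ] (hH : IsNativeSpace K H) : HasSpectralDensity H φ := by
  have hcont : Continuous fun x => (K x 0 : ℂ) :=
    Complex.continuous_ofReal.comp
      (hK.continuous.comp (by fun_prop : Continuous fun x : Eucl d => (x, (0 : Eucl d))))
  have hintC : Integrable fun ξ => (φ ξ : ℂ) := hint.ofReal
  have hae : (fun x => (K x 0 : ℂ)) =ᵐ[volume] 𝓕⁻ fun ξ => (φ ξ : ℂ) := by
    -- The hypothesis is tested against `𝓕⁻ ψ`, whose transform is `ψ`.
    refine ae_eq_fourierInv_of_forall_schwartz hcont.locallyIntegrable hintC fun ψ => ?_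
    rw [← hφ.2, FourierTransform.fourier_fourierInv_eq]
  have heq := Continuous.ae_eq_iff_eq volume hcont
    (continuous_fourierInv_of_integrable hintC) |>.1 hae
  refine ⟨hint, fun x y => ?_⟩
  rw [hH, ← congrFun heq]
  have := hK.translate (x - y) 0 y
  rw [sub_add_cancel, zero_add] at this
  rw [this]

/-- Minimal bump functions in the native space of a kernel with algebraically decaying Fourier
transform. -/
theorem bump_asymptotics_nativeSpace (hd : 0 < d) {β : ℝ} (hβ : (d : ℝ) < β)
    {K : Eucl d → Eucl d → ℝ} (hK : IsTranslationInvariantKernel K)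
    (hdecay : HasAlgebraicFourierDecay K β)
    {H : Type*} [NormedAddCommGroup H] [InnerProductSpace ℝ H] [CompleteSpace H]
    [RKHS ℝ H (Eucl d) ℝ] (hH : IsNativeSpace K H) :
    (∀ r : ℝ, 0 < r → ∃! b : H, IsNormMinimalBump r b) ∧
      (fun r => bumpNorm H r) =Θ[𝓝[>] (0 : ℝ)] fun r => r ^ ((d : ℝ) / 2 - β / 2) := by
  obtain ⟨φ, hφ, c, C, hc, hC, hbd⟩ := hdecay
  have hint : Integrable φ := by
    refine integrable_of_ae_le_inv_one_add_rpow hβ hφ.1.aestronglyMeasurable ?_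
      (hbd.mono fun _ h => h.2)
    filter_upwards [hbd] with ξ hξ
    exact le_trans (by positivity) hξ.1
  exact (hφ.hasSpectralDensity hK hint hH).bump_asymptotics hd hβ hc hC hbd

end AlgebraicDecay

/-! ### Transport along norm-preserving surjections -/

section Transport

variable {d : ℕ}

lemma mem_bumpSet_iff_of_coe_eq {F G : Type*} [FunLike F (Eucl d) ℝ] [FunLike G (Eucl d) ℝ]
    {S : F → G} (hS : ∀ f x, S f x = f x) {r : ℝ} {f : F} :
    S f ∈ bumpSet G r ↔ f ∈ bumpSet F r := by
  simp [bumpSet, hS]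

variable {F G : Type*} [Norm F] [FunLike F (Eucl d) ℝ] [Norm G] [FunLike G (Eucl d) ℝ]

lemma bumpNorm_eq_of_surjective {S : F → G} (hS : ∀ f x, S f x = f x) (hn : ∀ f, ‖S f‖ = ‖f‖)
    (hsurj : Function.Surjective S) (r : ℝ) : bumpNorm F r = bumpNorm G r := by
  unfold bumpNorm
  congr 1
  ext t
  constructor
  · rintro ⟨f, hf, rfl⟩
    exact ⟨S f, (mem_bumpSet_iff_of_coe_eq hS).2 hf, hn f⟩
  · rintro ⟨g, hg, rfl⟩
    obtain ⟨f, rfl⟩ := hsurj g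
    exact ⟨f, (mem_bumpSet_iff_of_coe_eq hS).1 hg, (hn f).symm⟩

lemma existsUnique_isNormMinimalBump_of_surjective {S : F → G} (hS : ∀ f x, S f x = f x)
    (hn : ∀ f, ‖S f‖ = ‖f‖) (hsurj : Function.Surjective S) {r : ℝ}
    (h : ∃! b : G, IsNormMinimalBump r b) : ∃! b : F, IsNormMinimalBump r b := by
  have hiff : ∀ f, IsNormMinimalBump r (S f) ↔ IsNormMinimalBump r f := fun f => by
    rw [IsNormMinimalBump, IsNormMinimalBump, mem_bumpSet_iff_of_coe_eq hS, hn,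
      bumpNorm_eq_of_surjective hS hn hsurj]
  obtain ⟨b, hb, huniq⟩ := h
  obtain ⟨f, rfl⟩ := hsurj b
  refine ⟨f, (hiff f).1 hb, fun g hg => DFunLike.ext _ _ fun x => ?_⟩
  rw [← hS, ← hS, huniq (S g) ((hiff g).2 hg)]

end Transport

/-! ### The Sobolev weight and its density -/

/-- The square root of the Sobolev frequency weight. -/
def sobolevWeight (d : ℕ) (m : ℝ) (ξ : Eucl d) : ℝ := (1 + (2 * Real.pi * ‖ξ‖) ^ 2) ^ (m / 2)

/-- The spectral density of the Sobolev space. -/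
def sobolevDensity (d : ℕ) (m : ℝ) (ξ : Eucl d) : ℝ := (1 + (2 * Real.pi * ‖ξ‖) ^ 2) ^ (-m)

section Weight

variable {d : ℕ} {m : ℝ}

lemma sobolevWeight_pos (ξ : Eucl d) : 0 < sobolevWeight d m ξ :=
  Real.rpow_pos_of_pos (by positivity) _

lemma sobolevWeight_sq (ξ : Eucl d) :
    sobolevWeight d m ξ ^ 2 = (1 + (2 * Real.pi * ‖ξ‖) ^ 2) ^ m := by
  rw [sobolevWeight, ← Real.rpow_natCast, ← Real.rpow_mul (by positivity)]
  congr 1; push_cast; ring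

lemma sobolevWeight_inv_sq (ξ : Eucl d) : (sobolevWeight d m ξ)⁻¹ ^ 2 = sobolevDensity d m ξ := by
  rw [inv_pow, sobolevWeight_sq, sobolevDensity, Real.rpow_neg (by positivity)]

lemma one_le_sobolevWeight (hm : 0 ≤ m) (ξ : Eucl d) : 1 ≤ sobolevWeight d m ξ :=
  Real.one_le_rpow (by nlinarith [sq_nonneg (2 * Real.pi * ‖ξ‖)]) (by positivity)

@[fun_prop]
lemma continuous_sobolevWeight : Continuous (sobolevWeight d m) :=
  Continuous.rpow_const (by fun_prop) fun ξ => .inl (by positivity)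

@[fun_prop]
lemma continuous_sobolevWeight_inv : Continuous fun ξ => (sobolevWeight d m ξ)⁻¹ :=
  continuous_sobolevWeight.inv₀ fun ξ => (sobolevWeight_pos ξ).ne'

lemma continuous_sobolevDensity : Continuous (sobolevDensity d m) :=
  Continuous.rpow_const (by fun_prop) fun ξ => .inl (by positivity)

lemma sobolevDensity_neg (ξ : Eucl d) : sobolevDensity d m (-ξ) = sobolevDensity d m ξ := by
  simp [sobolevDensity]

/-- With `t = ‖ξ‖`: `1 + (2πt)²` is at most `(1 + (2π)²) max (1, t²)`, and it dominates both `1` and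
`t²`, whence the constant `2`. -/
lemma sobolevDensity_bounds (hm : 0 ≤ m) (ξ : Eucl d) :
    ((1 + (2 * Real.pi) ^ 2) ^ m)⁻¹ * (1 + ‖ξ‖ ^ (2 * m))⁻¹ ≤ sobolevDensity d m ξ ∧
      sobolevDensity d m ξ ≤ 2 * (1 + ‖ξ‖ ^ (2 * m))⁻¹ := by
  have hpi : 1 ≤ 2 * Real.pi := by linarith [Real.pi_gt_three]
  have ht : ‖ξ‖ ^ (2 * m) = (‖ξ‖ ^ 2) ^ m := by
    rw [Real.rpow_mul (norm_nonneg _), Real.rpow_two]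
  rw [sobolevDensity, Real.rpow_neg (by positivity), ← mul_inv, ht]
  have h0 : 0 ≤ (‖ξ‖ ^ 2) ^ m := by positivity
  constructor
  · refine inv_anti₀ (by positivity) ?_
    rcases le_total ‖ξ‖ 1 with h | h
    · calc (1 + (2 * Real.pi * ‖ξ‖) ^ 2) ^ m ≤ (1 + (2 * Real.pi * 1) ^ 2) ^ m := by gcongr
        _ ≤ _ := by
          rw [mul_one]
          exact le_mul_of_one_le_right (by positivity) (by linarith)
    · calc (1 + (2 * Real.pi * ‖ξ‖) ^ 2) ^ m
          ≤ ((1 + (2 * Real.pi) ^ 2) * ‖ξ‖ ^ 2) ^ m := by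
            gcongr
            nlinarith [one_le_pow₀ h (n := 2)]
        _ = (1 + (2 * Real.pi) ^ 2) ^ m * (‖ξ‖ ^ 2) ^ m :=
          Real.mul_rpow (by positivity) (by positivity)
        _ ≤ _ := by gcongr; linarith
  · rw [← div_eq_mul_inv, inv_le_comm₀ (by positivity) (by positivity), inv_div,
      div_le_iff₀ two_pos]
    have h1 : 1 ≤ (1 + (2 * Real.pi * ‖ξ‖) ^ 2) ^ m :=
      Real.one_le_rpow (by nlinarith [sq_nonneg (2 * Real.pi * ‖ξ‖)]) hm
    have h2 : (‖ξ‖ ^ 2) ^ m ≤ (1 + (2 * Real.pi * ‖ξ‖) ^ 2) ^ m := by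
      gcongr
      have : ‖ξ‖ ^ 2 ≤ (2 * Real.pi * ‖ξ‖) ^ 2 := by
        gcongr
        exact le_mul_of_one_le_left (norm_nonneg _) hpi
      linarith
    linarith

lemma integrable_sobolevDensity (hm : (d : ℝ) / 2 < m) : Integrable (sobolevDensity d m) := by
  have hm0 : 0 ≤ m := (by positivity : (0 : ℝ) ≤ (d : ℝ) / 2).trans hm.le
  exact integrable_of_ae_le_inv_one_add_rpow (β := 2 * m) (by linarith)
    continuous_sobolevDensity.aestronglyMeasurable
    (ae_of_all _ fun ξ => Real.rpow_nonneg (by positivity) _)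
    (ae_of_all _ fun ξ => (sobolevDensity_bounds hm0 ξ).2)

/-- The Sobolev kernel is real. -/
lemma im_fourierInv_sobolevDensity (z : Eucl d) :
    -- Conjugation is undone by `ξ ↦ -ξ`, as the density is even.
    (𝓕⁻ (fun ξ => (sobolevDensity d m ξ : ℂ)) z).im = 0 := by
  rw [← Complex.conj_eq_iff_im, fourierInv_eq_integral_planeWave, ← integral_conj,
    ← integral_neg_eq_self]
  congr 1
  ext ξ
  rw [map_mul, star_planeWave, Complex.conj_ofReal, sobolevDensity_neg, ← neg_one_smul ℝ z,
    planeWave_smul, smul_neg, neg_one_smul, neg_neg]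

lemma memLp_sobolevWeight_inv (hm : (d : ℝ) / 2 < m) :
    MemLp (fun ξ => (((sobolevWeight d m ξ)⁻¹ : ℝ) : ℂ)) 2 (volume : Measure (Eucl d)) := by
  have h : MemLp (fun ξ => (sobolevWeight d m ξ)⁻¹) 2 (volume : Measure (Eucl d)) := by
    rw [memLp_two_iff_integrable_sq continuous_sobolevWeight_inv.aestronglyMeasurable]
    simp_rw [sobolevWeight_inv_sq]
    exact integrable_sobolevDensity hm
  exact h.ofReal

lemma memLp_planeWave_mul_sobolevWeight_inv (hm : (d : ℝ) / 2 < m) (x : Eucl d) :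
    MemLp (fun ξ => planeWave (-x) ξ * (((sobolevWeight d m ξ)⁻¹ : ℝ) : ℂ)) 2
      (volume : Measure (Eucl d)) := by
  refine (memLp_sobolevWeight_inv hm).of_le (by fun_prop) (ae_of_all _ fun ξ => ?_)
  rw [norm_mul, norm_planeWave, one_mul]

/-- Since `m > d/2`, the inverse weight is in `L²`, and a product of two `L²` functions is
integrable. Synthesis is thus a pointwise integral. -/
lemma integrable_sobolevWeight_inv_mul (hm : (d : ℝ) / 2 < m)
    (u : Lp ℂ 2 (volume : Measure (Eucl d))) :
    Integrable fun ξ => (((sobolevWeight d m ξ)⁻¹ : ℝ) : ℂ) * u ξ :=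
  (memLp_sobolevWeight_inv hm).integrable_mul (Lp.memLp u)

end Weight

/-! ### Fourier-side model of the Sobolev space -/

section Model

variable {d : ℕ} {m : ℝ}

/-- The function with weighted Fourier transform `u ∈ L²`. -/
def sobolevSynthesis (m : ℝ) (u : Lp ℂ 2 (volume : Measure (Eucl d))) : Eucl d → ℂ :=
  𝓕⁻ fun ξ => (((sobolevWeight d m ξ)⁻¹ : ℝ) : ℂ) * u ξ

variable [hm : Fact ((d : ℝ) / 2 < m)]

/-- The weighted Fourier transform of the Sobolev kernel centred at `x`. -/
def sobolevKernelFourier (m : ℝ) [hm : Fact ((d : ℝ) / 2 < m)] (x : Eucl d) :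
    Lp ℂ 2 (volume : Measure (Eucl d)) :=
  (memLp_planeWave_mul_sobolevWeight_inv hm.out x).toLp _

/-- The scalar `a` selects a part of the value at `x`: `1` gives the real part, `I` the imaginary
part. Real-valuedness thereby becomes an orthogonality condition. -/
lemma inner_smul_sobolevKernelFourier (a : ℂ) (x : Eucl d)
    (u : Lp ℂ 2 (volume : Measure (Eucl d))) :
    inner ℝ (a • sobolevKernelFourier m x) u =
      (starRingEnd ℂ a * sobolevSynthesis m u x).re := by
  rw [L2.inner_def, sobolevSynthesis, fourierInv_eq_integral_planeWave, ← integral_const_mul]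
  have hint := ((integrable_sobolevWeight_inv_mul hm.out u).planeWave_mul x).const_mul
    (starRingEnd ℂ a)
  rw [← RCLike.re_eq_complex_re, ← integral_re hint]
  refine integral_congr_ae ?_
  filter_upwards [Lp.coeFn_smul a (sobolevKernelFourier (d := d) m x),
    (memLp_planeWave_mul_sobolevWeight_inv (m := m) hm.out x).coeFn_toLp] with ξ h1 h2
  rw [h1, Pi.smul_apply, sobolevKernelFourier, h2, Complex.inner]
  simp only [smul_eq_mul, map_mul, star_planeWave, neg_neg, Complex.conj_ofReal,
    RCLike.re_eq_complex_re]
  congr 1; ring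

lemma inner_sobolevKernelFourier (x : Eucl d) (u : Lp ℂ 2 (volume : Measure (Eucl d))) :
    inner ℝ (sobolevKernelFourier m x) u = (sobolevSynthesis m u x).re := by
  have := inner_smul_sobolevKernelFourier (m := m) 1 x u
  rwa [one_smul, map_one, one_mul] at this

lemma inner_I_smul_sobolevKernelFourier (x : Eucl d) (u : Lp ℂ 2 (volume : Measure (Eucl d))) :
    inner ℝ (Complex.I • sobolevKernelFourier m x) u = (sobolevSynthesis m u x).im := by
  rw [inner_smul_sobolevKernelFourier]
  simp

/-- The Hilbert space of the weighted Fourier transforms `u ∈ L²` of real functions. -/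
def sobolevModel (d : ℕ) (m : ℝ) [Fact ((d : ℝ) / 2 < m)] :
    Submodule ℝ (Lp ℂ 2 (volume : Measure (Eucl d))) :=
  (Submodule.span ℝ (Set.range fun x => Complex.I • sobolevKernelFourier m x))ᗮ

lemma mem_sobolevModel_iff {u : Lp ℂ 2 (volume : Measure (Eucl d))} :
    u ∈ sobolevModel d m ↔ ∀ x, (sobolevSynthesis m u x).im = 0 := by
  simp_rw [← inner_I_smul_sobolevKernelFourier]
  rw [sobolevModel, Submodule.mem_orthogonal]
  refine ⟨fun h x => h _ (Submodule.subset_span ⟨x, rfl⟩), fun h v hv => ?_⟩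
  induction hv using Submodule.span_induction with
  | mem v hv => obtain ⟨x, rfl⟩ := hv; exact h x
  | zero => exact inner_zero_left _
  | add v w _ _ hv hw => rw [inner_add_left, hv, hw, add_zero]
  | smul a v _ hv => rw [real_inner_smul_left, hv, mul_zero]

instance : CompleteSpace (sobolevModel d m) := by
  unfold sobolevModel; infer_instance

lemma eq_zero_of_sobolevSynthesis_eq_zero {u : Lp ℂ 2 (volume : Measure (Eucl d))}
    (h : ∀ x, sobolevSynthesis m u x = 0) : u = 0 := by
  have h1 := ae_eq_zero_of_fourierInv_eq_zero (integrable_sobolevWeight_inv_mul hm.out u) h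
  rw [Lp.eq_zero_iff_ae_eq_zero]
  filter_upwards [h1] with ξ hξ
  have : (((sobolevWeight d m ξ)⁻¹ : ℝ) : ℂ) ≠ 0 :=
    Complex.ofReal_ne_zero.2 (inv_ne_zero (sobolevWeight_pos ξ).ne')
  exact (mul_eq_zero.1 hξ).resolve_left this

/-- Evaluation is the real part of synthesis; the imaginary part vanishes on the model, so
injectivity follows from Fourier uniqueness. -/
instance : RKHS ℝ (sobolevModel d m) (Eucl d) ℝ where
  coeCLM := .pi fun x => (innerSL ℝ (sobolevKernelFourier m x)) ∘L (sobolevModel d m).subtypeL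
  coeCLM_injective := by
    refine (injective_iff_map_eq_zero _).2 fun u hu => ?_
    refine Subtype.ext (eq_zero_of_sobolevSynthesis_eq_zero (m := m) fun x => Complex.ext ?_ ?_)
    · rw [← inner_sobolevKernelFourier]
      exact congrFun hu x
    · exact mem_sobolevModel_iff.1 u.2 x

lemma sobolevModel_apply (u : sobolevModel d m) (x : Eucl d) :
    ((u x : ℝ) : ℂ) = sobolevSynthesis m u x := by
  have h1 : u x = inner ℝ (sobolevKernelFourier m x) (u : Lp ℂ 2 (volume : Measure (Eucl d))) := rfl
  rw [h1, inner_sobolevKernelFourier]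
  exact Complex.ext rfl (mem_sobolevModel_iff.1 u.2 x).symm

lemma sobolevSynthesis_sobolevKernelFourier (x y : Eucl d) :
    sobolevSynthesis m (sobolevKernelFourier m y) x =
      𝓕⁻ (fun ξ => (sobolevDensity d m ξ : ℂ)) (x - y) := by
  rw [sobolevSynthesis, fourierInv_eq_integral_planeWave, fourierInv_eq_integral_planeWave]
  refine integral_congr_ae ?_
  filter_upwards [(memLp_planeWave_mul_sobolevWeight_inv (m := m) hm.out y).coeFn_toLp] with ξ hξ
  rw [sobolevKernelFourier, hξ, sub_eq_add_neg, planeWave_add, ← sobolevWeight_inv_sq]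
  push_cast; ring

lemma sobolevKernelFourier_mem (y : Eucl d) : sobolevKernelFourier m y ∈ sobolevModel d m := by
  rw [mem_sobolevModel_iff]
  intro x
  rw [sobolevSynthesis_sobolevKernelFourier, im_fourierInv_sobolevDensity]

lemma kerFun_sobolevModel (y : Eucl d) :
    RKHS.kerFun (sobolevModel d m) y 1 = ⟨sobolevKernelFourier m y, sobolevKernelFourier_mem y⟩ := by
  refine ext_inner_right ℝ fun u => ?_
  rw [real_inner_comm, inner_kerFun_one]
  rfl

lemma hasSpectralDensity_sobolevModel :
    HasSpectralDensity (sobolevModel d m) (sobolevDensity d m) := by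
  refine ⟨integrable_sobolevDensity hm.out, fun x y => ?_⟩
  rw [← RKHS.kerFun_apply, kerFun_sobolevModel, sobolevModel_apply,
    sobolevSynthesis_sobolevKernelFourier]

end Model

/-! ### Identification with the Sobolev space -/

section Sobolev

variable {d : ℕ} {m : ℝ}

/-- The weighted Fourier transform of a Sobolev function. -/
def SobolevSpace.weightedFourier (f : SobolevSpace d m) : Lp ℂ 2 (volume : Measure (Eucl d)) :=
  f.memLp_weighted.toLp _

lemma SobolevSpace.norm_weightedFourier (f : SobolevSpace d m) : ‖f.weightedFourier‖ = ‖f‖ := by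
  have h1 : ‖f‖ = Real.sqrt (∫ ξ, (1 + (2 * Real.pi * ‖ξ‖) ^ 2) ^ m *
    ‖(𝓕 (f.memLp_two.toLp _) : Lp ℂ 2 (volume : Measure (Eucl d))) ξ‖ ^ 2) := rfl
  rw [h1, ← Real.sqrt_sq (norm_nonneg f.weightedFourier), ← real_inner_self_eq_norm_sq,
    L2.inner_def]
  congr 1
  refine integral_congr_ae ?_
  filter_upwards [f.memLp_weighted.coeFn_toLp] with ξ hξ
  rw [real_inner_self_eq_norm_sq, weightedFourier, hξ, norm_mul, mul_pow, Complex.norm_real,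
    Real.norm_eq_abs, sq_abs, ← sobolevWeight_sq (m := m)]
  rfl

/-- Cancelling the weight shows that the `L²` transform of `f` is integrable; inversion then holds
almost everywhere, and everywhere by continuity. -/
lemma SobolevSpace.sobolevSynthesis_weightedFourier (hm : (d : ℝ) / 2 < m) (f : SobolevSpace d m)
    (x : Eucl d) : sobolevSynthesis m f.weightedFourier x = f x := by
  set h : Lp ℂ 2 (volume : Measure (Eucl d)) := 𝓕 (f.memLp_two.toLp _) with hh
  have hae : (fun ξ => (((sobolevWeight d m ξ)⁻¹ : ℝ) : ℂ) * f.weightedFourier ξ) =ᵐ[volume] h := by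
    filter_upwards [f.memLp_weighted.coeFn_toLp] with ξ hξ
    rw [weightedFourier, hξ, ← mul_assoc, ← Complex.ofReal_mul]
    change (((sobolevWeight d m ξ)⁻¹ * sobolevWeight d m ξ : ℝ) : ℂ) * _ = _
    rw [inv_mul_cancel₀ (sobolevWeight_pos ξ).ne', Complex.ofReal_one, one_mul]
  have hint := integrable_sobolevWeight_inv_mul hm f.weightedFourier
  have h1 := Lp_fourierInv_ae_eq_of_integrable h (hint.congr hae)
  rw [hh, FourierTransform.fourierInv_fourier_eq, ← hh] at h1
  have h2 : sobolevSynthesis m f.weightedFourier = 𝓕⁻ (h : Eucl d → ℂ) := by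
    ext x
    rw [sobolevSynthesis, fourierInv_eq_integral_planeWave, fourierInv_eq_integral_planeWave]
    refine integral_congr_ae ?_
    filter_upwards [hae] with ξ hξ
    rw [hξ]
  have h3 : sobolevSynthesis m f.weightedFourier =ᵐ[volume] fun x => (f.toFun x : ℂ) := by
    rw [h2]
    exact h1.symm.trans f.memLp_two.coeFn_toLp
  have h4 := (Continuous.ae_eq_iff_eq volume (continuous_fourierInv_of_integrable hint)
    (Complex.continuous_ofReal.comp f.continuous_toFun)).1 h3
  exact congrFun h4 x

variable [hm : Fact ((d : ℝ) / 2 < m)]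

/-- The Sobolev space is identified with the space of weighted Fourier transforms. -/
def SobolevSpace.toModel (f : SobolevSpace d m) : sobolevModel d m :=
  ⟨f.weightedFourier, mem_sobolevModel_iff.2 fun x => by
    rw [f.sobolevSynthesis_weightedFourier hm.out, Complex.ofReal_im]⟩

lemma SobolevSpace.toModel_apply (f : SobolevSpace d m) (x : Eucl d) : f.toModel x = f x := by
  apply Complex.ofReal_injective
  rw [sobolevModel_apply]
  exact f.sobolevSynthesis_weightedFourier hm.out x

/-- The preimage of `u` is its evaluation function. The weight is at least `1`, so `u` divided by it
stays in `L²`; this quotient is the transform of that function. -/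
lemma SobolevSpace.toModel_surjective :
    Function.Surjective (toModel : SobolevSpace d m → sobolevModel d m) := by
  intro u
  have hm0 : 0 ≤ m := (by positivity : (0 : ℝ) ≤ (d : ℝ) / 2).trans hm.out.le
  have hmem : MemLp (fun ξ => (((sobolevWeight d m ξ)⁻¹ : ℝ) : ℂ) *
      (u : Lp ℂ 2 (volume : Measure (Eucl d))) ξ) 2 (volume : Measure (Eucl d)) := by
    refine (Lp.memLp (u : Lp ℂ 2 (volume : Measure (Eucl d)))).of_le
      ((Complex.continuous_ofReal.comp continuous_sobolevWeight_inv).aestronglyMeasurable.mul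
        (Lp.aestronglyMeasurable _)) (ae_of_all _ fun ξ => ?_)
    rw [norm_mul, Complex.norm_real, Real.norm_of_nonneg (inv_nonneg.2 (sobolevWeight_pos ξ).le)]
    exact mul_le_of_le_one_left (norm_nonneg _) (inv_le_one_of_one_le₀ (one_le_sobolevWeight hm0 ξ))
  have hint := integrable_sobolevWeight_inv_mul hm.out (u : Lp ℂ 2 (volume : Measure (Eucl d)))
  have hcoe : (hmem.toLp _ : Eucl d → ℂ) =ᵐ[volume] _ := hmem.coeFn_toLp
  have hinv : (fun x => ((u x : ℝ) : ℂ)) =ᵐ[volume]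
      (𝓕⁻ (hmem.toLp _) : Lp ℂ 2 (volume : Measure (Eucl d))) := by
    refine EventuallyEq.trans (ae_of_all _ fun x => ?_)
      (Lp_fourierInv_ae_eq_of_integrable _ (hint.congr hcoe.symm)).symm
    beta_reduce
    rw [sobolevModel_apply, sobolevSynthesis, fourierInv_eq_integral_planeWave,
      fourierInv_eq_integral_planeWave]
    refine integral_congr_ae ?_
    filter_upwards [hcoe] with ξ hξ
    rw [hξ]
  have hu2 : MemLp (fun x => ((u x : ℝ) : ℂ)) 2 (volume : Measure (Eucl d)) :=
    (memLp_congr_ae hinv).2 (Lp.memLp _)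
  have hF : (𝓕 (hu2.toLp _) : Lp ℂ 2 (volume : Measure (Eucl d))) = hmem.toLp _ := by
    rw [Lp.ext (hu2.coeFn_toLp.trans hinv), FourierTransform.fourier_fourierInv_eq]
  have hcont : Continuous fun x => u x := by
    have h1 : Continuous fun x => (sobolevSynthesis m (u : Lp ℂ 2 (volume : Measure (Eucl d))) x).re :=
      Complex.continuous_re.comp (continuous_fourierInv_of_integrable hint)
    simpa only [← sobolevModel_apply, Complex.ofReal_re] using h1
  have hw : (fun ξ => (((1 + (2 * Real.pi * ‖ξ‖) ^ 2) ^ (m / 2) : ℝ) : ℂ) *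
      (𝓕 (hu2.toLp _) : Lp ℂ 2 (volume : Measure (Eucl d))) ξ) =ᵐ[volume]
        (u : Lp ℂ 2 (volume : Measure (Eucl d))) := by
    rw [hF]
    filter_upwards [hcoe] with ξ hξ
    rw [hξ, ← mul_assoc, ← Complex.ofReal_mul]
    change ((sobolevWeight d m ξ * (sobolevWeight d m ξ)⁻¹ : ℝ) : ℂ) * _ = _
    rw [mul_inv_cancel₀ (sobolevWeight_pos ξ).ne', Complex.ofReal_one, one_mul]
  refine ⟨⟨fun x => u x, hcont, hu2, (memLp_congr_ae hw).2 (Lp.memLp _)⟩, ?_⟩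
  refine DFunLike.ext _ _ fun x => ?_
  rw [toModel_apply]
  rfl

/-- Minimal bump functions in Sobolev spaces. -/
theorem bump_asymptotics_sobolevSpace (hd : 0 < d) :
    (∀ r : ℝ, 0 < r → ∃! b : SobolevSpace d m, IsNormMinimalBump r b) ∧
      (fun r => bumpNorm (SobolevSpace d m) r) =Θ[𝓝[>] (0 : ℝ)]
        fun r => r ^ ((d : ℝ) / 2 - m) := by
  have hm0 : 0 ≤ m := (by positivity : (0 : ℝ) ≤ (d : ℝ) / 2).trans hm.out.le
  have key := hasSpectralDensity_sobolevModel.bump_asymptotics hd (β := 2 * m)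
    (by linarith [hm.out]) (by positivity) two_pos
    (ae_of_all _ fun ξ => sobolevDensity_bounds (d := d) hm0 ξ)
  have hS := SobolevSpace.toModel_apply (d := d) (m := m)
  have hn : ∀ f : SobolevSpace d m, ‖f.toModel‖ = ‖f‖ := SobolevSpace.norm_weightedFourier
  have hsurj := SobolevSpace.toModel_surjective (d := d) (m := m)
  refine ⟨fun r hr => existsUnique_isNormMinimalBump_of_surjective hS hn hsurj (key.1 r hr), ?_⟩
  simp_rw [bumpNorm_eq_of_surjective hS hn hsurj]
  simpa using key.2

end Sobolev

end

theorem mainTheorem2 (d : ℕ) (hd : 0 < d) :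
    (∀ (β : ℝ), (d : ℝ) < β →
      ∀ K : Eucl d → Eucl d → ℝ, IsTranslationInvariantKernel K → HasAlgebraicFourierDecay K β →
      ∀ (H : Type*) [NormedAddCommGroup H] [InnerProductSpace ℝ H] [CompleteSpace H]
        [RKHS ℝ H (Eucl d) ℝ], IsNativeSpace K H →
        (∀ r : ℝ, 0 < r → ∃! b : H, IsNormMinimalBump r b) ∧
        (fun r => bumpNorm H r) =Θ[𝓝[>] (0 : ℝ)] fun r => r ^ ((d : ℝ) / 2 - β / 2)) ∧
    (∀ m : ℝ, (d : ℝ) / 2 < m →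
        (∀ r : ℝ, 0 < r → ∃! b : SobolevSpace d m, IsNormMinimalBump r b) ∧
        (fun r => bumpNorm (SobolevSpace d m) r) =Θ[𝓝[>] (0 : ℝ)]
          fun r => r ^ ((d : ℝ) / 2 - m)) :=
  ⟨fun _ hβ _ hK hdecay _ _ _ _ _ hH => bump_asymptotics_nativeSpace hd hβ hK hdecay hH,
    fun m hm => haveI : Fact ((d : ℝ) / 2 < m) := ⟨hm⟩; bump_asymptotics_sobolevSpace hd⟩
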